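/- Let $d\ge 1$ and $k\ge 0$ be integers. A *weighted point* in $\mathbb{R}^d$ is a pair $\mathbf a=(a,w_a)\in\mathbb{R}^d\times\mathbb{R}$ with location $a$ and (possibly negative) weight $w_a$; two weighted points $\mathbf a,\mathbf b$ are *orthogonal* if $\|a-b\|^2=w_a+w_b$. A set $A\subseteq\mathbb{R}^d$ is *thin Delone* if every closed ball contains only finitely many points of $A$ and every closed half-space contains at least one point of $A$. It is *generic* if no $d+1$ of its points lie on a common hyperplane and no $d+2$ of its points lie on a common $(d-1)$-sphere. A point $x$ is *generic with respect to $A$* if $x\notin A$ and $A\cup\{x\}$ is generic. Let $\mathbf A\subseteq\mathbb{R}^d\times\mathbb{R}$ be a set of weighted points in which every location carries exactly one weight, and let $A\subseteq\mathbb{R}^d$ be its set of locations. $\mathbf A$ is a *thin Delone set of weighted points* if $A$ is thin Delone and the absolute values of the weights are bounded. $\mathbf A$ is *generic* if $A$ is generic, for every $d+1$ weighted points of $\mathbf A$ there is a unique weighted point orthogonal to each of them, and different collections of $d+1$ weighted points have different such orthogonal weighted points. The *simplex* defined by $d+1$ weighted points of $\mathbf A$ is the convex hull of their locations. Its *heft*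 is the number of $\mathbf b=(b,w_b)\in\mathbf A$ with $\|z-b\|^2-w_z-w_b<0$, where $\mathbf z=(z,w_z)$ is the unique weighted point orthogonal to the $d+1$ weighted points. **Theorem.** Let $\mathbf A$ be a generic thin Delone set of weighted points in $\mathbb{R}^d$. 1. The simplices of heft $k$ cover $\mathbb{R}^d$ exactly $\binom{d+k}{d}$ times: every $x\in\mathbb{R}^d$ that is generic with respect to $A$, and hence Lebesgue-almost every $x\in\mathbb{R}^d$, belongs to exactly $\binom{d+k}{d}$ simplices of heft $k$, and every $x\in\mathbb{R}^d$ belongs to at least $\binom{d+k}{d}$ of them. 2. For every $\mathbf a\in\mathbf A$ with location $a$, the simplices of heft at most $k$ incident to $a$ (that is, with $a$ as a vertex) cover every sufficiently small neighborhood of $a$ at most $\binom{d+k}{d}$ times: there is $\varepsilon>0$ such that every $x$ in the open ball of radius $\varepsilon$ around $a$ that is generic with respect to $A$, and hence almost every $x$ in this ball, belongs to at most $\binom{d+k}{d}$ simplices of heft at most $k$ incident to $a$. -/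

import Mathlib

open MeasureTheory Topology

noncomputable section

namespace WeightedHefty

/-- A weighted point `(a, w)` in `ℝ^d`: a location and a real (possibly negative) weight. -/
abbrev WPoint (d : ℕ) : Type := EuclideanSpace ℝ (Fin d) × ℝ

/-- Every closed ball contains only finitely many points of `A`. -/
def IsLocallyFinite {d : ℕ} (A : Set (EuclideanSpace ℝ (Fin d))) : Prop :=
  ∀ (x : EuclideanSpace ℝ (Fin d)) (R : ℝ), (A ∩ Metric.closedBall x R).Finite

/-- Every closed half-space contains at least one point of `A`. -/
def IsCoarselyDense {d : ℕ} (A : Set (EuclideanSpace ℝ (Fin d))) : Prop :=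
  ∀ (u : EuclideanSpace ℝ (Fin d)) (c : ℝ), u ≠ 0 → ∃ a ∈ A, c ≤ inner ℝ u a

/-- Thin Delone sets: locally finite and coarsely dense. -/
def IsThinDelone {d : ℕ} (A : Set (EuclideanSpace ℝ (Fin d))) : Prop :=
  IsLocallyFinite A ∧ IsCoarselyDense A

/-- No `d + 1` points of `A` lie on a common hyperplane, and no `d + 2` points of `A` lie on a
common `(d-1)`-sphere. -/
def IsGeneric {d : ℕ} (A : Set (EuclideanSpace ℝ (Fin d))) : Prop :=
  (∀ S : Finset (EuclideanSpace ℝ (Fin d)), (S : Set (EuclideanSpace ℝ (Fin d))) ⊆ A →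
    S.card = d + 1 →
    ¬ ∃ (u : EuclideanSpace ℝ (Fin d)) (c : ℝ), u ≠ 0 ∧ ∀ p ∈ S, inner ℝ u p = c) ∧
  (∀ S : Finset (EuclideanSpace ℝ (Fin d)), (S : Set (EuclideanSpace ℝ (Fin d))) ⊆ A →
    S.card = d + 2 →
    ¬ ∃ (z : EuclideanSpace ℝ (Fin d)) (r : ℝ), ∀ p ∈ S, p ∈ Metric.sphere z r)

/-- The point `x` is generic with respect to `A`. -/
def IsGenericPoint {d : ℕ} (A : Set (EuclideanSpace ℝ (Fin d)))
    (x : EuclideanSpace ℝ (Fin d)) : Prop :=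
  x ∉ A ∧ IsGeneric (insert x A)

/-- The set of locations of a set of weighted points. -/
def locations {d : ℕ} (W : Set (WPoint d)) : Set (EuclideanSpace ℝ (Fin d)) :=
  Prod.fst '' W

/-- Two weighted points are orthogonal if the squared distance of their locations is the sum of
their weights. -/
def Orthogonal {d : ℕ} (p q : WPoint d) : Prop :=
  dist p.1 q.1 ^ 2 = p.2 + q.2

/-- A thin Delone set of weighted points: every location carries one weight, the locations form a
thin Delone set, and the absolute weights are bounded. -/
structure IsThinDeloneWeighted {d : ℕ} (W : Set (WPoint d)) : Prop where
  injOn : Set.InjOn Prod.fst W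
  thin : IsThinDelone (locations W)
  bounded : ∃ M : ℝ, ∀ p ∈ W, |p.2| ≤ M

/-- A generic set of weighted points: the set of locations is generic, any `d + 1` weighted points
have a unique weighted point orthogonal to all of them, and different collections of `d + 1`
weighted points have different such orthogonal weighted points. -/
structure IsGenericWeighted {d : ℕ} (W : Set (WPoint d)) : Prop where
  generic : IsGeneric (locations W)
  existsUnique : ∀ T : Finset (WPoint d), (T : Set (WPoint d)) ⊆ W → T.card = d + 1 →
    ∃! z : WPoint d, ∀ p ∈ T, Orthogonal z p
  distinct : ∀ T T' : Finset (WPoint d), (T : Set (WPoint d)) ⊆ W → T.card = d + 1 →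
    (T' : Set (WPoint d)) ⊆ W → T'.card = d + 1 →
    ∀ z : WPoint d, (∀ p ∈ T, Orthogonal z p) → (∀ p ∈ T', Orthogonal z p) → T = T'

/-- The weighted point orthogonal to all weighted points in `T`; only used for `d + 1` members of
a generic set, where it exists and is unique. -/
def orthoPoint {d : ℕ} (T : Finset (WPoint d)) : WPoint d :=
  Classical.epsilon fun z : WPoint d => ∀ p ∈ T, Orthogonal z p

/-- The heft in `W` of the simplex with weighted vertices `T`: the number of weighted points of `W`
closer than orthogonal to the weighted point orthogonal to the vertices. -/
def heft {d : ℕ} (W : Set (WPoint d)) (T : Finset (WPoint d)) : ℕ∞ :=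
  {q ∈ W | dist (orthoPoint T).1 q.1 ^ 2 - (orthoPoint T).2 - q.2 < 0}.encard

/-- The simplices of `W`, each represented by its `d + 1` weighted vertices. -/
def simplices {d : ℕ} (W : Set (WPoint d)) : Set (Finset (WPoint d)) :=
  {T | (T : Set (WPoint d)) ⊆ W ∧ T.card = d + 1}

/-- The number of simplices in the family `F` that contain `x`, where the simplex defined by `T` is
the convex hull of the locations of its members. -/
def coverCount {d : ℕ} (F : Set (Finset (WPoint d))) (x : EuclideanSpace ℝ (Fin d)) : ℕ∞ :=
  {T ∈ F | x ∈ convexHull ℝ (locations (T : Set (WPoint d)))}.encard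

end WeightedHefty

end

/-! Lift a weighted point `q` to height `‖q.1‖ ^ 2 - q.2`. A simplex `T` then spans the graph of an
affine function, `polar (orthoPoint T)`, and its heft counts the lifted points strictly below that
graph; call this finite set `V T`. Fix `x` off all hyperplanes through `d` locations.

Exact covering: delete a finite set `R`. Over `x`, the lower hull of the remaining lifted points has
exactly one facet, so exactly one `T` containing `x` satisfies `V T ⊆ R` and `T ∩ R = ∅`. Existence
is linear programming duality (`exists_supporting`, `exists_simplex`); uniqueness holds since each
of two such facets would lie strictly above the other at `x` (`polar_lt_of_not_below`). Counting the
pairs `(R, T)` with `R` an `r`-subset of a large finite set gives a triangular system for the number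
of simplices of each heft, with solution `(d + r).choose d` (`ncard_level_eq_choose`). Arbitrary `x`
follow by perturbation, as only finitely many simplices of bounded heft come near `x`.

Vertex bound: for simplices sharing the vertex `a`, the condition that `q` lies on the graph is
affine in the location of the orthogonal point. Multiplying over `q ∈ V T` gives polynomials of
degree at most `k` in `d` variables. Ordering the simplices by their value at `x` makes them
triangular under evaluation, hence independent, so the dimension `(d + k).choose d` bounds their
number. -/

namespace WeightedHefty

/-! ### Double counting -/

/-- Compare the coefficients of `X ^ r` in `(1 - X)⁻⁽ᵈ⁺¹⁾ (1 - X)⁻⁽ᵐ⁺¹⁾ = (1 - X)⁻⁽ᵈ⁺ᵐ⁺²⁾`. -/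
theorem sum_choose_mul_choose (d m r : ℕ) :
    ∑ i ∈ Finset.range (r + 1), (d + i).choose d * (m + (r - i)).choose m
      = (d + m + 1 + r).choose (d + m + 1) := by
  have h := congrArg (fun s : (PowerSeries ℤ)ˣ => PowerSeries.coeff r s.val)
    (PowerSeries.invOneSubPow_add (S := ℤ) (d + 1) (m + 1))
  have e : d + 1 + (m + 1) = (d + m + 1) + 1 := by ring
  simp only [e, Units.val_mul, PowerSeries.invOneSubPow_val_succ_eq_mk_add_choose,
    PowerSeries.coeff_mul, PowerSeries.coeff_mk] at h
  rw [Finset.Nat.sum_antidiagonal_eq_sum_range_succ_mk] at h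
  exact_mod_cast h.symm

theorem card_filter_subset_disjoint {α : Type*} [DecidableEq α] {S T V : Finset α}
    (hT : T ⊆ S) (hV : V ⊆ S) (hTV : Disjoint T V) {r : ℕ} (hr : V.card ≤ r) :
    ((Finset.powersetCard r S).filter fun R => V ⊆ R ∧ Disjoint T R).card
      = (S.card - T.card - V.card).choose (r - V.card) := by
  have hS : (S \ (T ∪ V)).card = S.card - T.card - V.card := by
    rw [Finset.card_sdiff_of_subset (Finset.union_subset hT hV),
      Finset.card_union_of_disjoint hTV, Nat.sub_sub]
  rw [← hS, ← Finset.card_powersetCard]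
  refine Finset.card_bij' (fun R _ => R \ V) (fun R _ => R ∪ V) ?_ ?_ ?_ ?_
  · intro R hR
    simp only [Finset.mem_filter, Finset.mem_powersetCard] at hR ⊢
    obtain ⟨⟨hRS, hRc⟩, hVR, hTR⟩ := hR
    refine ⟨fun q hq => ?_, by rw [Finset.card_sdiff_of_subset hVR, hRc]⟩
    simp only [Finset.mem_sdiff, Finset.mem_union] at hq ⊢
    exact ⟨hRS hq.1, fun h => h.elim (fun h => Finset.disjoint_left.1 hTR h hq.1) hq.2⟩
  · intro R hR
    simp only [Finset.mem_filter, Finset.mem_powersetCard] at hR ⊢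
    obtain ⟨hRS, hRc⟩ := hR
    have hd : Disjoint R (T ∪ V) :=
      Finset.disjoint_left.2 fun q hq => (Finset.mem_sdiff.1 (hRS hq)).2
    rw [Finset.disjoint_union_right] at hd
    refine ⟨⟨Finset.union_subset (hRS.trans Finset.sdiff_subset) hV, ?_⟩,
      Finset.subset_union_right, ?_⟩
    · rw [Finset.card_union_of_disjoint hd.2, hRc]; omega
    · rw [Finset.disjoint_union_right]
      exact ⟨hd.1.symm, hTV⟩
  · intro R hR
    simp only [Finset.mem_filter] at hR
    exact Finset.sdiff_union_of_subset hR.2.1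
  · intro R hR
    simp only [Finset.mem_powersetCard] at hR
    have hd : Disjoint R V := Finset.disjoint_left.2 fun q hq hv =>
      (Finset.mem_sdiff.1 (hR.1 hq)).2 (Finset.mem_union_right _ hv)
    exact Finset.union_sdiff_cancel_right hd

/-- If every finite `R` is avoided by exactly one `(d + 1)`-set `T` of the family whose
associated set `V T` lies in `R`, then the number of `T` with `r`-element `V T` is forced. -/
theorem ncard_level_eq_choose {α : Type*} [DecidableEq α] [Infinite α] {d k : ℕ}
    {F : Set (Finset α)} {V : Finset α → Finset α} (hcard : ∀ T ∈ F, T.card = d + 1)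
    (hdisj : ∀ T ∈ F, Disjoint T (V T)) (hfin : {T ∈ F | (V T).card ≤ k}.Finite)
    (hu : ∀ R, ∃! T, T ∈ F ∧ V T ⊆ R ∧ Disjoint T R) :
    ∀ r ≤ k, {T ∈ F | (V T).card = r}.ncard = (d + r).choose d := by
  set Φ := hfin.toFinset with hΦ
  have memΦ : ∀ T, T ∈ Φ ↔ T ∈ F ∧ (V T).card ≤ k := fun T => by simp [hΦ]
  have hN : ∀ r ≤ k, {T ∈ F | (V T).card = r}.ncard = (Φ.filter fun T => (V T).card = r).card := by
    intro r hr
    rw [← Set.ncard_coe_finset]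
    congr 1
    ext T
    simp only [Set.mem_ofPred_eq, Finset.coe_filter, memΦ]
    constructor
    · rintro ⟨h1, h2⟩; exact ⟨⟨h1, h2 ▸ hr⟩, h2⟩
    · rintro ⟨h1, h2⟩; exact ⟨h1.1, h2⟩
  -- Since `S` contains every `T ∪ V T`, the number of `r`-subsets compatible with `T` depends only
  -- on `(V T).card`. The size `d + 1 + k` keeps the later subtractions from truncating.
  obtain ⟨S, hS, hSn⟩ := Infinite.exists_superset_card_eq (Φ.biUnion fun T => T ∪ V T)
    (max (Φ.biUnion fun T => T ∪ V T).card (d + 1 + k)) (le_max_left _ _)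
  have hkS : d + 1 + k ≤ S.card := hSn ▸ le_max_right _ _
  have hTS : ∀ T ∈ Φ, T ∪ V T ⊆ S := fun T hT =>
    (Finset.subset_biUnion_of_mem (fun T => T ∪ V T) hT).trans hS
  intro r
  induction r using Nat.strong_induction_on with
  | _ r ih =>
  intro hr
  obtain ⟨m, hm⟩ : ∃ m, S.card = d + m + 1 + r := ⟨S.card - (d + 1 + r), by omega⟩
  have hcount := Finset.sum_card_bipartiteAbove_eq_sum_card_bipartiteBelow
    (s := Finset.powersetCard r S) (t := Φ) (fun R T => V T ⊆ R ∧ Disjoint T R)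
  have hleft : ∀ R ∈ Finset.powersetCard r S,
      (Finset.bipartiteAbove (fun R T => V T ⊆ R ∧ Disjoint T R) Φ R).card = 1 := by
    intro R hR
    obtain ⟨T, ⟨hTF, hTR⟩, huniq⟩ := hu R
    rw [Finset.card_eq_one]
    refine ⟨T, ?_⟩
    ext T'
    simp only [Finset.bipartiteAbove, Finset.mem_filter, memΦ, Finset.mem_singleton]
    constructor
    · rintro ⟨h1, h2⟩; exact huniq T' ⟨h1.1, h2⟩
    · rintro rfl
      exact ⟨⟨hTF, ((Finset.card_le_card hTR.1).trans (Finset.mem_powersetCard.1 hR).2.le).trans hr⟩,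
        hTR⟩
  rw [Finset.sum_congr rfl hleft, Finset.sum_const, smul_eq_mul, mul_one,
    Finset.card_powersetCard] at hcount
  have hright : ∑ T ∈ Φ, (Finset.bipartiteBelow (fun R T => V T ⊆ R ∧ Disjoint T R)
        (Finset.powersetCard r S) T).card
      = ∑ i ∈ Finset.range (r + 1),
        (Φ.filter fun T => (V T).card = i).card * (m + (r - i)).choose m := by
    rw [← Finset.sum_filter_add_sum_filter_not Φ (fun T => (V T).card ∈ Finset.range (r + 1))]
    rw [Finset.sum_eq_zero (s := Φ.filter fun T => ¬ (V T).card ∈ Finset.range (r + 1)), add_zero]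
    · rw [← Finset.sum_fiberwise_of_maps_to (t := Finset.range (r + 1)) (g := fun T => (V T).card)
        (fun T hT => (Finset.mem_filter.1 hT).2)]
      refine Finset.sum_congr rfl fun i hi => ?_
      rw [Finset.filter_filter, ← smul_eq_mul, ← Finset.sum_const]
      refine Finset.sum_congr ?_ ?_
      · ext T
        simp only [Finset.mem_filter]
        constructor
        · rintro ⟨h1, h2, h3⟩; exact ⟨h1, h3⟩
        · rintro ⟨h1, h3⟩; exact ⟨h1, h3 ▸ hi, h3⟩
      · intro T hT
        obtain ⟨hTΦ, hTi⟩ := Finset.mem_filter.1 hT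
        have hTF := ((memΦ T).1 hTΦ).1
        have hir : i ≤ r := by simpa [Nat.lt_succ_iff] using hi
        rw [Finset.bipartiteBelow, card_filter_subset_disjoint
          (Finset.subset_union_left.trans (hTS T hTΦ)) (Finset.subset_union_right.trans (hTS T hTΦ))
          (hdisj T hTF) (hTi ▸ hir), hcard T hTF, hTi]
        have : S.card - (d + 1) - i = m + (r - i) := by omega
        rw [this, Nat.choose_symm_add]
    · intro T hT
      rw [Finset.card_eq_zero, Finset.bipartiteBelow, Finset.filter_eq_empty_iff]
      intro R hR h
      refine (Finset.mem_filter.1 hT).2 (Finset.mem_range.2 (Nat.lt_succ_iff.2 ?_))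
      exact (Finset.card_le_card h.1).trans (Finset.mem_powersetCard.1 hR).2.le
  rw [hright, hm] at hcount
  have hsum := sum_choose_mul_choose d m r
  have hlow : ∑ i ∈ Finset.range r,
        (Φ.filter fun T => (V T).card = i).card * (m + (r - i)).choose m
      = ∑ i ∈ Finset.range r, (d + i).choose d * (m + (r - i)).choose m := by
    refine Finset.sum_congr rfl fun i hi => ?_
    have hir := Finset.mem_range.1 hi
    rw [← hN i (hir.le.trans hr), ih i hir (hir.le.trans hr)]
  -- The top term `i = r` has coefficient `m.choose m = 1`, so the count at level `r` is determined
  -- by the lower levels.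
  rw [Finset.sum_range_succ, hlow] at hcount
  rw [Finset.sum_range_succ, Nat.choose_symm_add (a := d + m + 1) (b := r), hcount] at hsum
  simp only [Nat.sub_self, add_zero, Nat.choose_self, mul_one] at hsum
  rw [hN r hr]
  omega

/-! ### Polynomials of bounded degree -/

/-- A slack exponent, indexed by `none`, turns total degree at most `k` into total degree exactly
`k` in `d + 1` variables; then stars and bars apply. -/
theorem finrank_restrictTotalDegree (d k : ℕ) :
    Module.finrank ℝ (MvPolynomial.restrictTotalDegree (Fin d) ℝ k) = (d + k).choose d := by
  classical
  have e : {s : Fin d →₀ ℕ | s.sum (fun _ e => e) ≤ k} ≃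
      Finset.finsuppAntidiag (Finset.univ : Finset (Option (Fin d))) k :=
    { toFun := fun s => ⟨Finsupp.optionElim (k - (s : Fin d →₀ ℕ).sum fun _ e => e) s, by
        have : (s : Fin d →₀ ℕ).sum (fun _ e => e) ≤ k := s.2
        rw [Finsupp.sum_fintype _ _ fun _ => rfl] at this
        simp [Finset.mem_finsuppAntidiag, Fintype.sum_option, Finsupp.sum_fintype]
        omega⟩
      invFun := fun s => ⟨Finsupp.some s, by
        have := s.2
        simp only [Finset.mem_finsuppAntidiag, Fintype.sum_option] at this
        simp [Finsupp.sum_fintype]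
        omega⟩
      left_inv := fun s => by ext; simp
      right_inv := fun s => by
        have := s.2
        simp only [Finset.mem_finsuppAntidiag, Fintype.sum_option] at this
        ext i
        cases i <;> simp [Finsupp.sum_fintype]
        omega }
  have hb : Module.finrank ℝ (MvPolynomial.restrictTotalDegree (Fin d) ℝ k)
      = Nat.card {s : Fin d →₀ ℕ | s.sum (fun _ e => e) ≤ k} :=
    Module.finrank_eq_nat_card_basis (MvPolynomial.basisRestrictSupport ℝ _)
  rw [hb, Nat.card_congr e, Nat.card_eq_fintype_card, Fintype.card_coe,
    Finset.card_finsuppAntidiag_nat_eq_choose, Finset.card_univ, Fintype.card_option,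
    Fintype.card_fin]
  have : d + 1 + k - 1 = d + k := by omega
  rw [this, Nat.choose_symm_add]

/-- The polynomial method for skew Bollobás systems. -/
theorem card_le_choose_of_triangular {ι : Type*} [Fintype ι] {d k : ℕ} (u : ι → Fin d → ℝ)
    (f : ι → MvPolynomial (Fin d) ℝ) (v : ι → ℝ) (hdeg : ∀ i, (f i).totalDegree ≤ k)
    (hdiag : ∀ i, MvPolynomial.eval (u i) (f i) ≠ 0)
    (htri : ∀ i j, i ≠ j → v i ≤ v j → MvPolynomial.eval (u i) (f j) = 0) :
    Fintype.card ι ≤ (d + k).choose d := by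
  classical
  let g : ι → MvPolynomial.restrictTotalDegree (Fin d) ℝ k := fun i =>
    ⟨f i, (MvPolynomial.mem_restrictTotalDegree _ _ _).2 (hdeg i)⟩
  have hli : LinearIndependent ℝ g := by
    rw [Fintype.linearIndependent_iff]
    intro c hc
    by_contra! hne
    obtain ⟨i₀, hi₀⟩ := hne
    -- Evaluating the relation at `u i`, for `i` of least `v` among the nonzero coefficients, kills
    -- every other term.
    obtain ⟨i, hi, hmin⟩ := Finset.exists_min_image (Finset.univ.filter fun i => c i ≠ 0) v
      ⟨i₀, by simpa using hi₀⟩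
    have h := congrArg (fun p : MvPolynomial.restrictTotalDegree (Fin d) ℝ k =>
      MvPolynomial.eval (u i) (p : MvPolynomial (Fin d) ℝ)) hc
    simp only [Submodule.coe_sum, Submodule.coe_smul, map_sum, MvPolynomial.smul_eval,
      Submodule.coe_zero, map_zero] at h
    rw [Finset.sum_eq_single i] at h
    · exact (mul_ne_zero (Finset.mem_filter.1 hi).2 (hdiag i)) h
    · intro j _ hj
      by_cases hcj : c j = 0
      · simp [hcj]
      · have := htri i j hj.symm (hmin j (by simpa using hcj))
        simp [g, this]
    · simp
  rw [← finrank_restrictTotalDegree]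
  exact hli.fintype_card_le_finrank

/-- The height of a weighted point when lifted to `ℝ^(d+1)`. -/
noncomputable def lift {d : ℕ} (q : WPoint d) : ℝ := ‖q.1‖ ^ 2 - q.2

/-- The affine function whose graph passes through the lifts of the weighted points
orthogonal to `z`. -/
noncomputable def polar {d : ℕ} (z : WPoint d) (y : EuclideanSpace ℝ (Fin d)) : ℝ :=
  2 * inner ℝ z.1 y + (z.2 - ‖z.1‖ ^ 2)

/-- `x` lies on no hyperplane through `d` points of `A`. -/
def OffHyperplanes {d : ℕ} (A : Set (EuclideanSpace ℝ (Fin d)))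
    (x : EuclideanSpace ℝ (Fin d)) : Prop :=
  ∀ S : Finset (EuclideanSpace ℝ (Fin d)), (S : Set (EuclideanSpace ℝ (Fin d))) ⊆ A →
    S.card = d → ∀ (u : EuclideanSpace ℝ (Fin d)) (c : ℝ), u ≠ 0 →
    (∀ p ∈ S, inner ℝ u p = c) → inner ℝ u x ≠ c

variable {d : ℕ}

theorem dist_sq_sub_eq (z q : WPoint d) :
    dist z.1 q.1 ^ 2 - z.2 - q.2 = lift q - polar z q.1 := by
  rw [dist_eq_norm, norm_sub_sq_real, lift, polar]
  ring

theorem orthogonal_iff (z q : WPoint d) : Orthogonal z q ↔ polar z q.1 = lift q := by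
  have := dist_sq_sub_eq z q
  unfold Orthogonal
  constructor <;> intro h <;> linarith

theorem polar_sub (z : WPoint d) (x y : EuclideanSpace ℝ (Fin d)) :
    polar z x - polar z y = 2 * inner ℝ z.1 (x - y) := by
  rw [polar, polar, inner_sub_right]; ring

theorem polar_sum (z : WPoint d) {T : Finset (WPoint d)} {w : WPoint d → ℝ}
    (hw : ∑ p ∈ T, w p = 1) : polar z (∑ p ∈ T, w p • p.1) = ∑ p ∈ T, w p * polar z p.1 := by
  simp only [polar, inner_sum, inner_smul_right, mul_add, Finset.sum_add_distrib,
    ← Finset.sum_mul, hw, one_mul, Finset.mul_sum]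
  congr 1
  exact Finset.sum_congr rfl fun _ _ => by ring

theorem heft_eq (W : Set (WPoint d)) (T : Finset (WPoint d)) :
    heft W T = {q ∈ W | lift q < polar (orthoPoint T) q.1}.encard := by
  unfold heft
  congr 1
  ext q
  have := dist_sq_sub_eq (orthoPoint T) q
  constructor <;> rintro ⟨h1, h2⟩ <;> exact ⟨h1, by linarith⟩

/-! ### Coarse density and finiteness -/

theorem exists_ne_zero_euclidean (hd : 1 ≤ d) : ∃ u : EuclideanSpace ℝ (Fin d), u ≠ 0 :=
  ⟨EuclideanSpace.single ⟨0, hd⟩ 1, by simp⟩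

theorem IsCoarselyDense.nonempty (hd : 1 ≤ d) {A : Set (EuclideanSpace ℝ (Fin d))}
    (hA : IsCoarselyDense A) : A.Nonempty := by
  obtain ⟨u, hu⟩ := exists_ne_zero_euclidean hd
  obtain ⟨a, ha, -⟩ := hA u 0 hu
  exact ⟨a, ha⟩

theorem IsCoarselyDense.mono {A B : Set (EuclideanSpace ℝ (Fin d))} (hA : IsCoarselyDense A)
    (h : A ⊆ B) : IsCoarselyDense B := fun u c hu =>
  let ⟨a, ha, hc⟩ := hA u c hu; ⟨a, h ha, hc⟩

theorem IsCoarselyDense.diff_finite {A R : Set (EuclideanSpace ℝ (Fin d))}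
    (hA : IsCoarselyDense A) (hR : R.Finite) : IsCoarselyDense (A \ R) := by
  intro u c hu
  obtain ⟨m, hm⟩ := (hR.image fun a => inner ℝ u a).bddAbove
  obtain ⟨a, ha, hc⟩ := hA u (max c (m + 1)) hu
  refine ⟨a, ⟨ha, fun haR => ?_⟩, (le_max_left _ _).trans hc⟩
  have h1 := hm ⟨a, haR, rfl⟩
  have h2 := (le_max_right c (m + 1)).trans hc
  simp only at h1
  linarith

theorem IsCoarselyDense.infinite (hd : 1 ≤ d) {A : Set (EuclideanSpace ℝ (Fin d))}
    (hA : IsCoarselyDense A) : A.Infinite := fun hfin => by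
  obtain ⟨a, ha, hn⟩ := (hA.diff_finite hfin).nonempty hd
  exact hn ha

/-- Compactness of the unit sphere of directions, then scaling. Bounding an affine function on `G`
thereby bounds its slope. -/
theorem IsCoarselyDense.exists_finset (hd : 1 ≤ d) {A : Set (EuclideanSpace ℝ (Fin d))}
    (hA : IsCoarselyDense A) (x : EuclideanSpace ℝ (Fin d)) (ρ : ℝ) :
    ∃ G : Finset (EuclideanSpace ℝ (Fin d)), (G : Set (EuclideanSpace ℝ (Fin d))) ⊆ A ∧
      ∀ u, ∃ a ∈ G, ρ * ‖u‖ ≤ inner ℝ u (a - x) := by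
  classical
  obtain ⟨a₀, ha₀⟩ := hA.nonempty hd
  obtain ⟨t, ht⟩ := (isCompact_sphere (0 : EuclideanSpace ℝ (Fin d)) 1).elim_finite_subcover
    (fun a : A => {u | ρ < inner ℝ u ((a : EuclideanSpace ℝ (Fin d)) - x)})
    (fun a => isOpen_lt continuous_const (by fun_prop)) (by
      intro u hu
      have hu1 : ‖u‖ = 1 := by simpa using hu
      obtain ⟨a, ha, hc⟩ := hA u (inner ℝ u x + ρ + 1) (by rintro rfl; simp at hu1)
      refine Set.mem_iUnion.2 ⟨⟨a, ha⟩, ?_⟩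
      change ρ < inner ℝ u (a - x)
      rw [inner_sub_right]; linarith)
  refine ⟨insert a₀ (t.image Subtype.val), ?_, fun u => ?_⟩
  · intro a ha
    simp only [Finset.coe_insert, Finset.coe_image, Set.mem_insert_iff, Set.mem_image] at ha
    rcases ha with rfl | ⟨b, -, rfl⟩
    · exact ha₀
    · exact b.2
  · by_cases hu : u = 0
    · exact ⟨a₀, Finset.mem_insert_self _ _, by simp [hu]⟩
    · have hpos : 0 < ‖u‖ := norm_pos_iff.2 hu
      have hs : ‖u‖⁻¹ • u ∈ Metric.sphere (0 : EuclideanSpace ℝ (Fin d)) 1 := by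
        simp [norm_smul, hpos.ne']
      obtain ⟨a, hat, ha⟩ := Set.mem_iUnion₂.1 (ht hs)
      refine ⟨a, Finset.mem_insert_of_mem (Finset.mem_image_of_mem _ hat), ?_⟩
      change ρ < inner ℝ (‖u‖⁻¹ • u) ((a : EuclideanSpace ℝ (Fin d)) - x) at ha
      rw [real_inner_smul_left, inv_mul_eq_div, lt_div_iff₀ hpos] at ha
      exact ha.le

/-- The union of `k + 1` disjoint finite sets, each good in all directions: a set of `k` points must
miss one of them. -/
theorem IsCoarselyDense.exists_finset_avoiding (hd : 1 ≤ d)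
    {A : Set (EuclideanSpace ℝ (Fin d))} (hA : IsCoarselyDense A)
    (x : EuclideanSpace ℝ (Fin d)) (ρ : ℝ) (k : ℕ) :
    ∃ G : Finset (EuclideanSpace ℝ (Fin d)), (G : Set (EuclideanSpace ℝ (Fin d))) ⊆ A ∧
      ∀ u, ∀ V : Finset (EuclideanSpace ℝ (Fin d)), V.card ≤ k →
        ∃ a ∈ G, a ∉ V ∧ ρ * ‖u‖ ≤ inner ℝ u (a - x) := by
  classical
  induction k with
  | zero =>
    obtain ⟨G, hG, h⟩ := hA.exists_finset hd x ρ
    refine ⟨G, hG, fun u V hV => ?_⟩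
    obtain ⟨a, ha, h⟩ := h u
    exact ⟨a, ha, by simp [Finset.card_eq_zero.1 (Nat.le_zero.1 hV)], h⟩
  | succ k ih =>
    obtain ⟨G, hG, h⟩ := ih
    obtain ⟨G', hG', h'⟩ := (hA.diff_finite G.finite_toSet).exists_finset hd x ρ
    refine ⟨G ∪ G', ?_, fun u V hV => ?_⟩
    · rw [Finset.coe_union]
      exact Set.union_subset hG (hG'.trans Set.sdiff_subset)
    · obtain ⟨a, ha, hau⟩ := h' u
      by_cases haV : a ∈ V
      · obtain ⟨b, hb, hbV, hbu⟩ := h u (V.erase a) (by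
          rw [Finset.card_erase_of_mem haV]; omega)
        refine ⟨b, Finset.mem_union_left _ hb, fun hbV' => hbV ?_, hbu⟩
        refine Finset.mem_erase.2 ⟨?_, hbV'⟩
        rintro rfl
        exact (hG' ha).2 hb
      · exact ⟨a, Finset.mem_union_right _ ha, haV, hau⟩

variable {W : Set (WPoint d)}

theorem IsThinDeloneWeighted.exists_le_lift (hW : IsThinDeloneWeighted W) :
    ∃ M : ℝ, 0 ≤ M ∧ ∀ p ∈ W, ‖p.1‖ ^ 2 - M ≤ lift p := by
  obtain ⟨M, hM⟩ := hW.bounded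
  refine ⟨|M|, abs_nonneg _, fun p hp => ?_⟩
  have := (le_abs_self p.2).trans ((hM p hp).trans (le_abs_self M))
  unfold lift
  linarith

theorem IsThinDeloneWeighted.finite_norm_le (hW : IsThinDeloneWeighted W) (B : ℝ) :
    {p ∈ W | ‖p.1‖ ≤ B}.Finite := by
  refine Set.Finite.of_finite_image (f := Prod.fst) ((hW.thin.1 0 B).subset ?_)
    (hW.injOn.mono fun p hp => hp.1)
  rintro _ ⟨p, ⟨hp, hB⟩, rfl⟩
  exact ⟨⟨p, hp, rfl⟩, by simpa using hB⟩

theorem le_of_sq_le_linear {s C₁ C₂ : ℝ} (h : s ^ 2 ≤ C₁ + C₂ * s) :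
    s ≤ |C₁| + |C₂| + 1 := by
  by_contra! hs
  have h1 := le_abs_self C₁
  have h2 := le_abs_self C₂
  have h3 := abs_nonneg C₁
  have h4 := abs_nonneg C₂
  nlinarith

/-- Bounded weights make `lift` grow quadratically, which eventually beats any linear bound. -/
theorem IsThinDeloneWeighted.finite_lift_le (hW : IsThinDeloneWeighted W) (C₁ C₂ : ℝ) :
    {p ∈ W | lift p ≤ C₁ + C₂ * ‖p.1‖}.Finite := by
  obtain ⟨M, -, hM⟩ := hW.exists_le_lift
  refine (hW.finite_norm_le (|C₁ + M| + |C₂| + 1)).subset ?_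
  rintro p ⟨hp, hC⟩
  refine ⟨hp, le_of_sq_le_linear ?_⟩
  have := hM p hp
  linarith

theorem polar_le (z : WPoint d) (y : EuclideanSpace ℝ (Fin d)) :
    polar z y ≤ (z.2 - ‖z.1‖ ^ 2) + 2 * ‖z.1‖ * ‖y‖ := by
  have := real_inner_le_norm z.1 y
  unfold polar
  linarith

theorem IsThinDeloneWeighted.finite_below (hW : IsThinDeloneWeighted W) (z : WPoint d) :
    {q ∈ W | lift q < polar z q.1}.Finite :=
  (hW.finite_lift_le (z.2 - ‖z.1‖ ^ 2) (2 * ‖z.1‖)).subset fun q hq =>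
    ⟨hq.1, hq.2.le.trans (polar_le z q.1)⟩

/-! ### Convex hulls and general position -/

theorem mem_convexHull_locations {T : Finset (WPoint d)}
    (hT : Set.InjOn Prod.fst (T : Set (WPoint d))) {x : EuclideanSpace ℝ (Fin d)} :
    x ∈ convexHull ℝ (locations (T : Set (WPoint d))) ↔
      ∃ w : WPoint d → ℝ, (∀ p ∈ T, 0 ≤ w p) ∧ ∑ p ∈ T, w p = 1 ∧ ∑ p ∈ T, w p • p.1 = x := by
  classical
  have e : locations (T : Set (WPoint d))
      = ((T.image Prod.fst : Finset (EuclideanSpace ℝ (Fin d))) : Set _) := by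
    rw [Finset.coe_image, locations]
  rw [e, Finset.mem_convexHull']
  constructor
  · rintro ⟨w, h0, h1, hx⟩
    rw [Finset.sum_image hT] at h1 hx
    exact ⟨fun p => w p.1, fun p hp => h0 _ (Finset.mem_image_of_mem _ hp), h1, hx⟩
  · rintro ⟨w, h0, h1, hx⟩
    have hinv : ∀ p ∈ T, Function.invFunOn Prod.fst (T : Set (WPoint d)) p.1 = p := fun p hp =>
      hT.leftInvOn_invFunOn hp
    refine ⟨fun y => w (Function.invFunOn Prod.fst (T : Set (WPoint d)) y), ?_, ?_, ?_⟩
    · intro y hy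
      obtain ⟨p, hp, rfl⟩ := Finset.mem_image.1 hy
      simpa only [hinv p hp] using h0 p hp
    · rw [Finset.sum_image hT, ← h1]
      exact Finset.sum_congr rfl fun p hp => by rw [hinv p hp]
    · rw [Finset.sum_image hT, ← hx]
      exact Finset.sum_congr rfl fun p hp => by simp only [hinv p hp]

/-- There are `d` homogeneous linear equations in the `d + 1` unknowns `(u, c)`. In a nonzero
solution `u = 0` would force `c = 0`, as `S` is nonempty. -/
theorem exists_hyperplane (hd : 1 ≤ d) {S : Finset (EuclideanSpace ℝ (Fin d))}
    (hS : S.card = d) : ∃ (u : EuclideanSpace ℝ (Fin d)) (c : ℝ), u ≠ 0 ∧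
      ∀ p ∈ S, inner ℝ u p = c := by
  let f : (EuclideanSpace ℝ (Fin d) × ℝ) →ₗ[ℝ] (S → ℝ) := LinearMap.pi fun p =>
    (innerₗ (EuclideanSpace ℝ (Fin d)) (p : EuclideanSpace ℝ (Fin d))).comp
      (LinearMap.fst ℝ _ _) - LinearMap.snd ℝ _ _
  have hf : LinearMap.ker f ≠ ⊥ := f.ker_ne_bot_of_finrank_lt (by simp [hS])
  obtain ⟨⟨u, c⟩, hmem, hne⟩ := Submodule.exists_mem_ne_zero_of_ne_bot hf
  have h : ∀ p ∈ S, inner ℝ u p = c := fun p hp => by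
    have := congrFun (LinearMap.mem_ker.1 hmem) ⟨p, hp⟩
    simp only [f, LinearMap.pi_apply, LinearMap.sub_apply, LinearMap.comp_apply,
      LinearMap.fst_apply, LinearMap.snd_apply, innerₗ_apply_apply, Pi.zero_apply] at this
    rw [real_inner_comm]
    linarith
  refine ⟨u, c, ?_, h⟩
  rintro rfl
  obtain ⟨p, hp⟩ := Finset.card_pos.1 (hS ▸ hd)
  have := h p hp
  rw [inner_zero_left] at this
  exact hne (by rw [← this]; rfl)

theorem OffHyperplanes.notMem_convexHull (hd : 1 ≤ d) {A : Set (EuclideanSpace ℝ (Fin d))}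
    (hA : A.Infinite) {x : EuclideanSpace ℝ (Fin d)} (hx : OffHyperplanes A x)
    {S : Finset (EuclideanSpace ℝ (Fin d))} (hS : (S : Set (EuclideanSpace ℝ (Fin d))) ⊆ A)
    (hc : S.card ≤ d) : x ∉ convexHull ℝ (S : Set (EuclideanSpace ℝ (Fin d))) := by
  classical
  obtain ⟨S', hSS', hS'A, hS'⟩ : ∃ S' : Finset (EuclideanSpace ℝ (Fin d)), S ⊆ S' ∧
      (S' : Set (EuclideanSpace ℝ (Fin d))) ⊆ A ∧ S'.card = d := by
    obtain ⟨t, htA, htc⟩ := hA.exists_subset_card_eq d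
    obtain ⟨S', h1, h2, h3⟩ := Finset.exists_subsuperset_card_eq (Finset.subset_union_left (s₂ := t))
      hc (htc.ge.trans (Finset.card_le_card Finset.subset_union_right))
    refine ⟨S', h1, fun p hp => ?_, h3⟩
    rcases Finset.mem_union.1 (h2 hp) with h | h
    exacts [hS h, htA h]
  obtain ⟨u, c, hu, h⟩ := exists_hyperplane hd hS'
  intro hxS
  refine hx S' hS'A hS' u c hu h ?_
  have hconv : Convex ℝ {y | inner ℝ u y = c} := convex_hyperplane (innerₗ _ u).isLinear c
  exact convexHull_min (fun p hp => h p (hSS' hp)) hconv hxS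

theorem OffHyperplanes.weight_pos (hd : 1 ≤ d) (hW : IsThinDeloneWeighted W)
    {x : EuclideanSpace ℝ (Fin d)} (hx : OffHyperplanes (locations W) x)
    {T : Finset (WPoint d)} (hT : T ∈ simplices W) {w : WPoint d → ℝ} (h0 : ∀ p ∈ T, 0 ≤ w p)
    (h1 : ∑ p ∈ T, w p = 1) (hwx : ∑ p ∈ T, w p • p.1 = x) : ∀ p ∈ T, 0 < w p := by
  classical
  intro p hp
  refine (h0 p hp).lt_of_ne fun hwp => ?_
  have hsub : ((T.erase p : Finset (WPoint d)) : Set (WPoint d)) ⊆ W := fun q hq =>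
    hT.1 (Finset.mem_of_mem_erase hq)
  refine hx.notMem_convexHull hd (hW.thin.2.infinite hd) (S := (T.erase p).image Prod.fst) ?_ ?_ ?_
  · rw [Finset.coe_image]
    exact Set.image_mono hsub
  · refine Finset.card_image_le.trans ?_
    rw [Finset.card_erase_of_mem hp, hT.2]; rfl
  · rw [Finset.coe_image]
    refine (mem_convexHull_locations (hW.injOn.mono hsub)).2
      ⟨w, fun q hq => h0 q (Finset.mem_of_mem_erase hq), ?_, ?_⟩
    · rw [Finset.sum_erase _ hwp.symm, h1]
    · rw [Finset.sum_erase _ (by rw [← hwp, zero_smul]), hwx]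

theorem polar_orthoPoint (hg : IsGenericWeighted W) {T : Finset (WPoint d)}
    (hT : T ∈ simplices W) : ∀ p ∈ T, polar (orthoPoint T) p.1 = lift p := by
  intro p hp
  obtain ⟨z, hz, -⟩ := hg.existsUnique T hT.1 hT.2
  rw [← orthogonal_iff]
  exact Classical.epsilon_spec (p := fun z : WPoint d => ∀ p ∈ T, Orthogonal z p) ⟨z, hz⟩ p hp

theorem orthoPoint_eq (hg : IsGenericWeighted W) {T : Finset (WPoint d)}
    (hT : T ∈ simplices W) {z : WPoint d} (hz : ∀ p ∈ T, polar z p.1 = lift p) :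
    orthoPoint T = z :=
  (hg.existsUnique T hT.1 hT.2).unique
    (fun p hp => (orthogonal_iff _ _).2 (polar_orthoPoint hg hT p hp))
    fun p hp => (orthogonal_iff _ _).2 (hz p hp)

/-- Otherwise exchanging a vertex of `T` for `q` would give a second collection with the same
orthogonal point. -/
theorem mem_of_polar_eq (hg : IsGenericWeighted W) {T : Finset (WPoint d)}
    (hT : T ∈ simplices W) {z : WPoint d} (hz : ∀ p ∈ T, polar z p.1 = lift p)
    {q : WPoint d} (hq : q ∈ W) (hzq : polar z q.1 = lift q) : q ∈ T := by
  classical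
  by_contra hqT
  obtain ⟨p, hp⟩ := Finset.card_pos.1 (by rw [hT.2]; omega : 0 < T.card)
  have hT' : ((insert q (T.erase p) : Finset (WPoint d)) : Set (WPoint d)) ⊆ W := by
    intro r hr
    rcases Finset.mem_insert.1 hr with rfl | hr
    exacts [hq, hT.1 (Finset.mem_of_mem_erase hr)]
  have hc : (insert q (T.erase p)).card = d + 1 := by
    rw [Finset.card_insert_of_notMem fun h => hqT (Finset.mem_of_mem_erase h),
      Finset.card_erase_of_mem hp, hT.2]
    rfl
  have := hg.distinct T _ hT.1 hT.2 hT' hc z (fun p hp => (orthogonal_iff _ _).2 (hz p hp))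
    (fun r hr => (orthogonal_iff _ _).2 (by
      rcases Finset.mem_insert.1 hr with rfl | hr
      exacts [hzq, hz r (Finset.mem_of_mem_erase hr)]))
  exact hqT (this ▸ Finset.mem_insert_self _ _)

/-- A simplex containing `x` none of whose vertices is below the hyperplane of another such
simplex has the larger value at `x`. -/
theorem polar_lt_of_not_below (hd : 1 ≤ d) (hW : IsThinDeloneWeighted W)
    (hg : IsGenericWeighted W) {x : EuclideanSpace ℝ (Fin d)}
    (hx : OffHyperplanes (locations W) x) {T T' : Finset (WPoint d)} (hT : T ∈ simplices W)
    (hT' : T' ∈ simplices W) (hxT : x ∈ convexHull ℝ (locations (T : Set (WPoint d))))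
    (hne : T ≠ T') (hb : ∀ p ∈ T, polar (orthoPoint T') p.1 ≤ lift p) :
    polar (orthoPoint T') x < polar (orthoPoint T) x := by
  obtain ⟨w, h0, h1, hwx⟩ := (mem_convexHull_locations (hW.injOn.mono hT.1)).1 hxT
  have hpos := hx.weight_pos hd hW hT h0 h1 hwx
  rw [← hwx, polar_sum _ h1, polar_sum _ h1]
  refine Finset.sum_lt_sum (fun p hp => ?_) ?_
  · rw [polar_orthoPoint hg hT p hp]
    exact mul_le_mul_of_nonneg_left (hb p hp) (h0 p hp)
  -- Strictness comes from a vertex outside `T'`: it is strictly above the other graph, and its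
  -- barycentric weight is positive because `x` is off the hyperplanes.
  · obtain ⟨p, hp, hpT'⟩ : ∃ p ∈ T, p ∉ T' := by
      by_contra! h
      exact hne (Finset.eq_of_subset_of_card_le h (by rw [hT.2, hT'.2]))
    refine ⟨p, hp, ?_⟩
    rw [polar_orthoPoint hg hT p hp]
    refine mul_lt_mul_of_pos_left ((hb p hp).lt_of_ne fun h => hpT' ?_) (hpos p hp)
    exact mem_of_polar_eq hg hT' (polar_orthoPoint hg hT') (hT.1 hp) h

/-- Linear programming duality: the highest affine function at `x` below all lifted points is
supported by lifted points whose locations surround `x`. -/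
theorem exists_supporting (hd : 1 ≤ d) (hW : IsThinDeloneWeighted W) {W' : Set (WPoint d)}
    (hsub : W' ⊆ W) (hdense : IsCoarselyDense (locations W'))
    (x : EuclideanSpace ℝ (Fin d)) :
    ∃ z : WPoint d, (∀ q ∈ W', polar z q.1 ≤ lift q) ∧
      x ∈ convexHull ℝ (locations {q ∈ W' | polar z q.1 = lift q}) := by
  obtain ⟨M, hM0, hM⟩ := hW.exists_le_lift
  obtain ⟨G, hG, hGx⟩ := hdense.exists_finset hd x 1
  obtain ⟨H, hH⟩ : ∃ H : ℝ, ∀ a ∈ G, ∃ q ∈ W', q.1 = a ∧ lift q ≤ H := by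
    choose! f hf hfa using fun a (ha : a ∈ (G : Set (EuclideanSpace ℝ (Fin d)))) => hG ha
    obtain ⟨H, hH⟩ := (G.finite_toSet.image fun a => lift (f a)).bddAbove
    exact ⟨H, fun a ha => ⟨f a, hf a ha, hfa a ha, hH ⟨a, ha, rfl⟩⟩⟩
  -- The pair `(u, c)` encodes the affine function `y ↦ ⟪u, y - x⟫ + c`, with value `c` at `x`. The
  -- cut `-M ≤ c` is met by the constant `-M`; together with the constraints from `G` it makes the
  -- feasible set compact.
  let K : Set (EuclideanSpace ℝ (Fin d) × ℝ) :=
    {p | -M ≤ p.2 ∧ ∀ q ∈ W', inner ℝ p.1 (q.1 - x) + p.2 ≤ lift q}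
  have hKclosed : IsClosed K := by
    have : K = {p | -M ≤ p.2} ∩ ⋂ q ∈ W', {p | inner ℝ p.1 (q.1 - x) + p.2 ≤ lift q} := by
      ext p; simp [K]
    rw [this]
    refine (isClosed_le continuous_const continuous_snd).inter
      (isClosed_biInter fun q _ => isClosed_le (by fun_prop) continuous_const)
  have hKsub : K ⊆ Metric.closedBall 0 (H + M) ×ˢ Set.Icc (-M) H := by
    rintro ⟨u, c⟩ ⟨hc, hq⟩
    obtain ⟨a, ha, hua⟩ := hGx u
    obtain ⟨q, hqW, rfl, hqH⟩ := hH a ha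
    have h1 := hq q hqW
    have h2 := norm_nonneg u
    simp only at h1 hc
    refine ⟨?_, hc, ?_⟩
    · rw [mem_closedBall_zero_iff]; simp only; linarith
    · simp only; linarith
  have hKcompact : IsCompact K :=
    ((isCompact_closedBall _ _).prod isCompact_Icc).of_isClosed_subset hKclosed hKsub
  have hKne : K.Nonempty := by
    refine ⟨(0, -M), le_rfl, fun q hq => ?_⟩
    have := hM q (hsub hq)
    have := sq_nonneg ‖q.1‖
    simp only [inner_zero_left]
    linarith
  obtain ⟨⟨u, c⟩, ⟨hc, hle⟩, hmax⟩ := hKcompact.exists_isMaxOn hKne continuous_snd.continuousOn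
  simp only at hc hle
  have hpolar : ∀ y, polar (((1 / 2 : ℝ) • u, c - inner ℝ u x + ‖(1 / 2 : ℝ) • u‖ ^ 2) : WPoint d) y
      = inner ℝ u (y - x) + c := fun y => by
    simp only [polar, real_inner_smul_left, inner_sub_right]; ring
  refine ⟨((1 / 2 : ℝ) • u, c - inner ℝ u x + ‖(1 / 2 : ℝ) • u‖ ^ 2), fun q hq => ?_, ?_⟩
  · rw [hpolar]; exact hle q hq
  simp only [hpolar]
  -- If `x` is outside the hull of the contact points, separate it by `f` and add `t * (f - s)` for
  -- small `t > 0`: the function drops at the contact points but rises at `x`, against maximality.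
  by_contra hx
  have hfin : (locations {q ∈ W' | inner ℝ u (q.1 - x) + c = lift q}).Finite := by
    refine Set.Finite.image _ ((hW.finite_lift_le (‖u‖ * ‖x‖ + c) ‖u‖).subset ?_)
    rintro q ⟨hq, hqe⟩
    refine ⟨hsub hq, ?_⟩
    have h1 := real_inner_le_norm u (q.1 - x)
    have h2 := mul_le_mul_of_nonneg_left (norm_sub_le q.1 x) (norm_nonneg u)
    linarith
  obtain ⟨f, s, hfs, hsx⟩ := geometric_hahn_banach_closed_point (convex_convexHull ℝ _)
    (hfin.isClosed_convexHull ℝ) hx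
  -- Only these finitely many constraints restrict `t`; all others survive every `t ≤ 1`.
  have hgap : {q ∈ W' | lift q ≤ inner ℝ u (q.1 - x) + c + (f q.1 - s)}.Finite := by
    refine (hW.finite_lift_le (‖u‖ * ‖x‖ + c - s) (‖u‖ + ‖f‖)).subset ?_
    rintro q ⟨hq, hqe⟩
    refine ⟨hsub hq, ?_⟩
    have h1 := real_inner_le_norm u (q.1 - x)
    have h2 := mul_le_mul_of_nonneg_left (norm_sub_le q.1 x) (norm_nonneg u)
    have h3 := (le_abs_self _).trans (f.le_opNorm q.1)
    linarith
  have hev : ∀ᶠ t : ℝ in 𝓝[>] 0, ∀ q ∈ {q ∈ W' | lift q ≤ inner ℝ u (q.1 - x) + c + (f q.1 - s)},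
      t * (f q.1 - s) ≤ lift q - (inner ℝ u (q.1 - x) + c) := by
    rw [Filter.eventually_all_finite hgap]
    rintro q ⟨hq, -⟩
    rcases (hle q hq).eq_or_lt with h | h
    · filter_upwards [self_mem_nhdsWithin] with t ht
      have h1 := hfs q.1 (subset_convexHull ℝ _ ⟨q, ⟨hq, h⟩, rfl⟩)
      rw [h, sub_self]
      exact mul_nonpos_of_nonneg_of_nonpos (le_of_lt ht) (by linarith)
    · have ht : Filter.Tendsto (fun t : ℝ => t * (f q.1 - s)) (𝓝 0) (𝓝 (0 * (f q.1 - s))) :=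
        (continuous_id.mul continuous_const).tendsto 0
      rw [zero_mul] at ht
      exact ((ht.eventually_lt_const (sub_pos.2 h)).mono fun t h => h.le).filter_mono
        nhdsWithin_le_nhds
  obtain ⟨t, ⟨ht, ht0⟩, ht1⟩ := ((hev.and self_mem_nhdsWithin).and
    (nhdsWithin_le_nhds (Iic_mem_nhds one_pos))).exists
  have ht0 : 0 < t := ht0
  have ht1 : t ≤ 1 := ht1
  set v := (InnerProductSpace.toDual ℝ (EuclideanSpace ℝ (Fin d))).symm f with hv
  have hvf : ∀ y, inner ℝ v y = f y := fun y => by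
    rw [hv, InnerProductSpace.toDual_symm_apply]
  have hδ : 0 < t * (f x - s) := mul_pos ht0 (sub_pos.2 hsx)
  have hmem : (u + t • v, c + t * (f x - s)) ∈ K := by
    refine ⟨by simp only; linarith, fun q hq => ?_⟩
    have e : inner ℝ (u + t • v) (q.1 - x) + (c + t * (f x - s))
        = (inner ℝ u (q.1 - x) + c) + t * (f q.1 - s) := by
      rw [inner_add_left, real_inner_smul_left, hvf, map_sub]; ring
    simp only
    rw [e]
    by_cases h : lift q ≤ inner ℝ u (q.1 - x) + c + (f q.1 - s)
    · linarith [ht q ⟨hq, h⟩]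
    · push Not at h
      rcases le_total (f q.1 - s) 0 with h0 | h0
      · linarith [mul_nonpos_of_nonneg_of_nonpos ht0.le h0, hle q hq]
      · linarith [mul_le_of_le_one_left h0 ht1]
  have := isMaxOn_iff.1 hmax _ hmem
  simp only at this
  linarith

/-- The optimal affine function for `W \ R` touches at least `d + 1` lifted points because `x` is
off the hyperplanes, and no more by genericity. -/
theorem exists_simplex (hd : 1 ≤ d) (hW : IsThinDeloneWeighted W) (hg : IsGenericWeighted W)
    {x : EuclideanSpace ℝ (Fin d)} (hx : OffHyperplanes (locations W) x)
    {R : Set (WPoint d)} (hR : R.Finite) :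
    ∃ T ∈ simplices W, x ∈ convexHull ℝ (locations (T : Set (WPoint d))) ∧
      (∀ q ∈ W, lift q < polar (orthoPoint T) q.1 → q ∈ R) ∧ ∀ p ∈ T, p ∉ R := by
  classical
  have hdense : IsCoarselyDense (locations (W \ R)) := by
    refine (hW.thin.2.diff_finite (hR.image Prod.fst)).mono ?_
    rintro _ ⟨⟨q, hq, rfl⟩, hn⟩
    exact ⟨q, ⟨hq, fun h => hn ⟨q, h, rfl⟩⟩, rfl⟩
  obtain ⟨z, hz, hxz⟩ := exists_supporting hd hW Set.sdiff_subset hdense x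
  have hfin : {q ∈ W \ R | polar z q.1 = lift q}.Finite :=
    (hW.finite_lift_le (z.2 - ‖z.1‖ ^ 2) (2 * ‖z.1‖)).subset fun q hq =>
      ⟨hq.1.1, hq.2.ge.trans (polar_le z q.1)⟩
  obtain ⟨T, hT⟩ := hfin.exists_finset_coe
  have memT : ∀ q, q ∈ T ↔ (q ∈ W ∧ q ∉ R) ∧ polar z q.1 = lift q := fun q => by
    rw [← Finset.mem_coe, hT]; rfl
  rw [← hT] at hxz
  have hTW : (T : Set (WPoint d)) ⊆ W := fun q hq => ((memT q).1 hq).1.1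
  have hge : d + 1 ≤ T.card := by
    by_contra! h
    refine hx.notMem_convexHull hd (hW.thin.2.infinite hd) (S := T.image Prod.fst) ?_ ?_ ?_
    · rw [Finset.coe_image]; exact Set.image_mono hTW
    · exact Finset.card_image_le.trans (Nat.lt_succ_iff.1 h)
    · rw [Finset.coe_image]; exact hxz
  obtain ⟨T', hT'T, hT'⟩ := Finset.exists_subset_card_eq hge
  have hT's : T' ∈ simplices W := ⟨fun q hq => hTW (hT'T hq), hT'⟩
  have hz' : ∀ p ∈ T', polar z p.1 = lift p := fun p hp => ((memT p).1 (hT'T hp)).2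
  have hTT' : T = T' := Finset.Subset.antisymm
    (fun q hq => mem_of_polar_eq hg hT's hz' (hTW hq) ((memT q).1 hq).2) hT'T
  subst hTT'
  refine ⟨T, hT's, hxz, fun q hq hlt => ?_, fun p hp => ((memT p).1 hp).1.2⟩
  rw [orthoPoint_eq hg hT's hz'] at hlt
  by_contra hqR
  exact absurd (hz q ⟨hq, hqR⟩) hlt.not_ge

/-- The graph is at least `-M` above `y`, and heft at most `k` forces some low point of `G` in the
uphill direction not to be below it. So its slope is bounded, and the lifted vertices obey a linear
height bound. Allowing a whole ball of `y` serves the perturbation of `x`. -/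
theorem finite_simplices_near (hd : 1 ≤ d) (hW : IsThinDeloneWeighted W)
    (hg : IsGenericWeighted W) (k : ℕ) (x : EuclideanSpace ℝ (Fin d)) :
    {T ∈ simplices W | heft W T ≤ k ∧ ∃ y ∈ Metric.closedBall x 1,
      y ∈ convexHull ℝ (locations (T : Set (WPoint d)))}.Finite := by
  classical
  obtain ⟨M, hM0, hM⟩ := hW.exists_le_lift
  -- With `ρ = 2` the rise from `x` to the chosen point is at least `4 * ‖z.1‖`; moving from `x` to
  -- `y` costs at most `2 * ‖z.1‖`.
  obtain ⟨G, hG, hGx⟩ := hW.thin.2.exists_finset_avoiding hd x 2 k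
  obtain ⟨H, hH⟩ : ∃ H : ℝ, ∀ a ∈ G, ∃ q ∈ W, q.1 = a ∧ lift q ≤ H := by
    choose! f hf hfa using fun a (ha : a ∈ (G : Set (EuclideanSpace ℝ (Fin d)))) => hG ha
    obtain ⟨H, hH⟩ := (G.finite_toSet.image fun a => lift (f a)).bddAbove
    exact ⟨H, fun a ha => ⟨f a, hf a ha, hfa a ha, hH ⟨a, ha, rfl⟩⟩⟩
  set C := H + (H + M) * (‖x‖ + 1) with hC
  have hP := hW.finite_lift_le C (H + M)
  refine (hP.finite_subsets.preimage Finset.coe_injective.injOn).subset ?_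
  rintro T ⟨hT, hk, y, hy, hyT⟩
  obtain ⟨w, h0, h1, hwy⟩ := (mem_convexHull_locations (hW.injOn.mono hT.1)).1 hyT
  set z := orthoPoint T
  have hyM : -M ≤ polar z y := by
    rw [← hwy, polar_sum z h1, ← mul_one (-M), mul_comm, ← h1, Finset.sum_mul]
    refine Finset.sum_le_sum fun p hp => mul_le_mul_of_nonneg_left ?_ (h0 p hp)
    rw [polar_orthoPoint hg hT p hp]
    linarith [hM p (hT.1 hp), sq_nonneg ‖p.1‖]
  have hfinV := hW.finite_below z
  have hVk : (hfinV.toFinset.image Prod.fst).card ≤ k := by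
    refine Finset.card_image_le.trans ?_
    rw [heft_eq, hfinV.encard_eq_coe_toFinset_card] at hk
    exact_mod_cast hk
  obtain ⟨a, ha, haV, hua⟩ := hGx ((2 : ℝ) • z.1) _ hVk
  obtain ⟨q, hqW, rfl, hqH⟩ := hH a ha
  have hq : polar z q.1 ≤ lift q := by
    by_contra! h
    exact haV (Finset.mem_image_of_mem _ (hfinV.mem_toFinset.2 ⟨hqW, h⟩))
  rw [norm_smul, Real.norm_two, real_inner_smul_left] at hua
  rw [Metric.mem_closedBall, dist_eq_norm] at hy
  have e1 : polar z q.1 = polar z y + 2 * inner ℝ z.1 (q.1 - x) - 2 * inner ℝ z.1 (y - x) := by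
    rw [← polar_sub, ← polar_sub]; ring
  have e2 : inner ℝ z.1 (y - x) ≤ ‖z.1‖ :=
    (real_inner_le_norm _ _).trans (mul_le_of_le_one_right (norm_nonneg _) hy)
  have hzn := norm_nonneg z.1
  have hz1 : 2 * ‖z.1‖ ≤ H + M := by linarith
  have hyH : polar z y ≤ H := by linarith
  have hyn : ‖y‖ ≤ ‖x‖ + 1 := by
    have := norm_add_le x (y - x)
    rw [add_sub_cancel] at this
    linarith
  intro p hp
  refine ⟨hT.1 hp, ?_⟩
  have e3 := polar_sub z p.1 y
  have e4 := real_inner_le_norm z.1 (p.1 - y)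
  have e5 := norm_sub_le p.1 y
  have e6 : 2 * (‖z.1‖ * ‖p.1 - y‖) ≤ (H + M) * (‖p.1‖ + (‖x‖ + 1)) := by
    rw [← mul_assoc]
    exact mul_le_mul hz1 (by linarith) (norm_nonneg _) (by linarith)
  rw [← polar_orthoPoint hg hT p hp]
  change polar z p.1 ≤ _
  rw [hC]
  linarith

/-! ### Almost every point is off the hyperplanes -/

theorem IsGenericPoint.offHyperplanes {A : Set (EuclideanSpace ℝ (Fin d))}
    {x : EuclideanSpace ℝ (Fin d)} (hx : IsGenericPoint A x) : OffHyperplanes A x := by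
  classical
  intro S hS hc u c hu h hux
  refine hx.2.1 (insert x S) ?_ ?_ ⟨u, c, hu, fun p hp => ?_⟩
  · rw [Finset.coe_insert]; exact Set.insert_subset_insert hS
  · rw [Finset.card_insert_of_notMem fun h => hx.1 (hS h), hc]
  · rcases Finset.mem_insert.1 hp with rfl | hp
    exacts [hux, h p hp]

theorem volume_hyperplane {u : EuclideanSpace ℝ (Fin d)} (hu : u ≠ 0) (c : ℝ) :
    volume {x : EuclideanSpace ℝ (Fin d) | inner ℝ u x = c} = 0 := by
  rcases Set.eq_empty_or_nonempty {x : EuclideanSpace ℝ (Fin d) | inner ℝ u x = c} with h | ⟨y, hy⟩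
  · rw [h, measure_empty]
  have hy : inner ℝ u y = c := hy
  set s := AffineSubspace.mk' y (LinearMap.ker (innerₗ (EuclideanSpace ℝ (Fin d)) u)) with hs
  have e : {x : EuclideanSpace ℝ (Fin d) | inner ℝ u x = c} = s := by
    ext x
    rw [SetLike.mem_coe, hs, AffineSubspace.mem_mk', LinearMap.mem_ker, innerₗ_apply_apply,
      vsub_eq_sub, inner_sub_right, hy, sub_eq_zero]
    rfl
  rw [e]
  refine Measure.addHaar_affineSubspace volume s fun htop => ?_
  have h1 : y + u ∈ s := htop ▸ AffineSubspace.mem_top _ _ _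
  rw [hs, AffineSubspace.mem_mk', LinearMap.mem_ker, innerₗ_apply_apply, vsub_eq_sub,
    add_sub_cancel_left, inner_self_eq_zero] at h1
  exact hu h1

theorem IsLocallyFinite.countable {A : Set (EuclideanSpace ℝ (Fin d))}
    (hA : IsLocallyFinite A) : A.Countable := by
  refine (Set.countable_iUnion fun n : ℕ => (hA 0 n).countable).mono fun a ha => ?_
  obtain ⟨n, hn⟩ := exists_nat_ge ‖a‖
  exact Set.mem_iUnion.2 ⟨n, ha, by simpa using hn⟩

theorem ae_offHyperplanes {A : Set (EuclideanSpace ℝ (Fin d))} (hA : IsLocallyFinite A)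
    (hg : IsGeneric A) (hinf : A.Infinite) :
    ∀ᵐ x : EuclideanSpace ℝ (Fin d), OffHyperplanes A x := by
  classical
  have hcount : {S : Finset (EuclideanSpace ℝ (Fin d)) |
      (S : Set (EuclideanSpace ℝ (Fin d))) ⊆ A}.Countable := by
    refine Set.Countable.mono (fun S hS => ?_)
      ((Set.countable_ofPred_finite_subset hA.countable).preimage Finset.coe_injective)
    exact ⟨S.finite_toSet, hS⟩
  unfold OffHyperplanes
  have : ∀ᵐ x : EuclideanSpace ℝ (Fin d), ∀ S ∈ {S : Finset (EuclideanSpace ℝ (Fin d)) |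
      (S : Set (EuclideanSpace ℝ (Fin d))) ⊆ A}, S.card = d →
      ∀ (u : EuclideanSpace ℝ (Fin d)) (c : ℝ), u ≠ 0 →
      (∀ p ∈ S, inner ℝ u p = c) → inner ℝ u x ≠ c := by
    rw [ae_ball_iff hcount]
    intro S hS
    by_cases hex : S.card = d ∧ ∃ (u : EuclideanSpace ℝ (Fin d)) (c : ℝ), u ≠ 0 ∧
      ∀ p ∈ S, inner ℝ u p = c
    swap
    · exact Filter.Eventually.of_forall fun x hc u c hu h => absurd ⟨hc, u, c, hu, h⟩ hex
    obtain ⟨hc, u₀, c₀, hu₀, h₀⟩ := hex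
    obtain ⟨q, hqA, hqS⟩ := hinf.exists_notMem_finset S
    have hins : ∀ (u : EuclideanSpace ℝ (Fin d)) (c : ℝ), (∀ p ∈ insert q S, inner ℝ u p = c) →
        u = 0 := by
      intro u c h
      by_contra hu
      refine hg.1 (insert q S) ?_ (by rw [Finset.card_insert_of_notMem hqS, hc]) ⟨u, c, hu, h⟩
      rw [Finset.coe_insert]
      exact Set.insert_subset hqA hS
    have hq₀ : inner ℝ u₀ q - c₀ ≠ 0 := fun h => hu₀ (hins u₀ c₀ fun p hp => by
      rcases Finset.mem_insert.1 hp with rfl | hp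
      exacts [sub_eq_zero.1 h, h₀ p hp])
    have hnull : ∀ᵐ x : EuclideanSpace ℝ (Fin d), inner ℝ u₀ x ≠ c₀ := by
      rw [ae_iff]
      simpa using volume_hyperplane hu₀ c₀
    filter_upwards [hnull] with x hx _ u c hu h hux
    -- This combination of the two hyperplane equations through `S` also vanishes at `q`, so
    -- genericity makes it trivial: the hyperplanes coincide.
    set α := inner ℝ u q - c with hα
    set β := inner ℝ u₀ q - c₀ with hβ
    have hzero := hins (β • u - α • u₀) (β * c - α * c₀) fun p hp => by
      rw [inner_sub_left, real_inner_smul_left, real_inner_smul_left]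
      rcases Finset.mem_insert.1 hp with rfl | hp
      · rw [hα, hβ]; ring
      · rw [h p hp, h₀ p hp]
    have hq := congrArg (fun v => inner ℝ v q) hzero
    have hxx := congrArg (fun v => inner ℝ v x) hzero
    simp only [inner_sub_left, real_inner_smul_left, inner_zero_left] at hq hxx
    have hα0 : α ≠ 0 := fun h0 => by
      rw [h0, zero_smul, sub_zero, smul_eq_zero] at hzero
      exact hzero.elim hq₀ hu
    apply hx
    have : α * (inner ℝ u₀ x - c₀) = 0 := by
      have e1 : inner ℝ u q = α + c := by rw [hα]; ring
      have e2 : inner ℝ u₀ q = β + c₀ := by rw [hβ]; ring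
      rw [e1, e2] at hq
      rw [hux] at hxx
      linarith
    exact sub_eq_zero.1 ((mul_eq_zero.1 this).resolve_left hα0)
  filter_upwards [this] with x hx S hS
  exact hx S hS

/-! ### Exact covering -/

theorem heft_eq_card (hW : IsThinDeloneWeighted W) (T : Finset (WPoint d)) :
    heft W T = ((hW.finite_below (orthoPoint T)).toFinset.card : ℕ∞) := by
  rw [heft_eq, (hW.finite_below _).encard_eq_coe_toFinset_card]

theorem coverCount_heft_eq (hd : 1 ≤ d) (k : ℕ) (hW : IsThinDeloneWeighted W)
    (hg : IsGenericWeighted W) {x : EuclideanSpace ℝ (Fin d)}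
    (hx : OffHyperplanes (locations W) x) :
    coverCount {T ∈ simplices W | heft W T = (k : ℕ∞)} x = ((d + k).choose d : ℕ∞) := by
  classical
  have hfin := finite_simplices_near hd hW hg k x
  have hlevel := ncard_level_eq_choose (d := d) (k := k)
    (F := {T ∈ simplices W | x ∈ convexHull ℝ (locations (T : Set (WPoint d)))})
    (V := fun T => (hW.finite_below (orthoPoint T)).toFinset) (fun T hT => hT.1.2) ?_ ?_ ?_ k le_rfl
  · have e : {T ∈ {T ∈ simplices W | heft W T = (k : ℕ∞)} |
          x ∈ convexHull ℝ (locations (T : Set (WPoint d)))}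
        = {T ∈ {T ∈ simplices W | x ∈ convexHull ℝ (locations (T : Set (WPoint d)))} |
          (hW.finite_below (orthoPoint T)).toFinset.card = k} := by
      ext T
      have hT := heft_eq_card hW T
      constructor
      · rintro ⟨⟨h1, h2⟩, h3⟩
        exact ⟨⟨h1, h3⟩, by rw [hT] at h2; exact_mod_cast h2⟩
      · rintro ⟨⟨h1, h3⟩, h2⟩
        exact ⟨⟨h1, by rw [hT]; exact_mod_cast h2⟩, h3⟩
    rw [coverCount, e, ← hlevel, Set.Finite.cast_ncard_eq]
    refine hfin.subset ?_
    rintro T ⟨⟨h1, h3⟩, h2⟩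
    refine ⟨h1, ?_, x, Metric.mem_closedBall_self zero_le_one, h3⟩
    rw [heft_eq_card hW T]
    exact_mod_cast h2.le
  · intro T hT
    refine Finset.disjoint_left.2 fun p hp hpV => ?_
    exact ((hW.finite_below _).mem_toFinset.1 hpV).2.ne' (polar_orthoPoint hg hT.1 p hp)
  · refine hfin.subset ?_
    rintro T ⟨⟨h1, h3⟩, h2⟩
    refine ⟨h1, ?_, x, Metric.mem_closedBall_self zero_le_one, h3⟩
    rw [heft_eq_card hW T]
    exact_mod_cast h2
  · intro R
    obtain ⟨T, hT, hxT, hTR, hTd⟩ := exists_simplex hd hW hg hx R.finite_toSet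
    refine ⟨T, ⟨⟨hT, hxT⟩, fun q hq => ?_, Finset.disjoint_left.2 hTd⟩, ?_⟩
    · have := (hW.finite_below _).mem_toFinset.1 hq
      exact hTR q this.1 this.2
    · rintro T' ⟨⟨hT', hxT'⟩, hVR, hT'd⟩
      by_contra hne
      refine lt_asymm
        (polar_lt_of_not_below hd hW hg hx hT hT' hxT (Ne.symm hne) fun p hp => ?_)
        (polar_lt_of_not_below hd hW hg hx hT' hT hxT' hne fun p hp => ?_)
      · by_contra! h
        exact hTd p hp (hVR ((hW.finite_below _).mem_toFinset.2 ⟨hT.1 hp, h⟩))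
      · by_contra! h
        exact Finset.disjoint_left.1 hT'd hp (hTR p (hT'.1 hp) h)

theorem ae_offHyperplanes_locations (hd : 1 ≤ d) (hW : IsThinDeloneWeighted W)
    (hg : IsGenericWeighted W) :
    ∀ᵐ x : EuclideanSpace ℝ (Fin d), OffHyperplanes (locations W) x :=
  ae_offHyperplanes hW.thin.1 hg.generic (hW.thin.2.infinite hd)

/-- Move `x` to a nearby `y` off the hyperplanes. The finitely many relevant simplices are closed,
so for `y` close enough those containing `y` also contain `x`. -/
theorem choose_le_coverCount_heft (hd : 1 ≤ d) (k : ℕ) (hW : IsThinDeloneWeighted W)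
    (hg : IsGenericWeighted W) (x : EuclideanSpace ℝ (Fin d)) :
    ((d + k).choose d : ℕ∞) ≤
      coverCount {T ∈ simplices W | heft W T = (k : ℕ∞)} x := by
  have hfin := finite_simplices_near hd hW hg k x
  have hev : ∀ᶠ y in 𝓝 x, ∀ T ∈ {T ∈ simplices W | heft W T ≤ k ∧ ∃ y ∈ Metric.closedBall x 1,
      y ∈ convexHull ℝ (locations (T : Set (WPoint d)))},
      y ∈ convexHull ℝ (locations (T : Set (WPoint d))) →
      x ∈ convexHull ℝ (locations (T : Set (WPoint d))) := by
    rw [Filter.eventually_all_finite hfin]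
    intro T _
    by_cases h : x ∈ convexHull ℝ (locations (T : Set (WPoint d)))
    · exact Filter.Eventually.of_forall fun _ _ => h
    · have hc : IsClosed (convexHull ℝ (locations (T : Set (WPoint d)))) :=
        (T.finite_toSet.image Prod.fst).isClosed_convexHull ℝ
      filter_upwards [hc.isOpen_compl.mem_nhds h] with y hy hyT
      exact absurd hyT hy
  obtain ⟨U, hU, hUo, hxU⟩ := mem_nhds_iff.1
    (Filter.inter_mem hev (Metric.closedBall_mem_nhds x one_pos))
  have hdense := Measure.dense_of_ae (ae_offHyperplanes_locations hd hW hg)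
  obtain ⟨y, hyU, hy⟩ := hdense.inter_open_nonempty U hUo ⟨x, hxU⟩
  rw [← coverCount_heft_eq hd k hW hg hy]
  refine Set.encard_le_encard ?_
  rintro T ⟨⟨h1, h2⟩, h3⟩
  exact ⟨⟨h1, h2⟩, (hU hyU).1 T ⟨h1, h2.le, y, (hU hyU).2, h3⟩ h3⟩

/-! ### Simplices sharing a vertex -/

/-- The difference between the hyperplane dual to `z` and the lift of `q`, as a polynomial in the
location of `z`, for `z` orthogonal to `a`. -/
noncomputable def gapPolynomial (a q : WPoint d) : MvPolynomial (Fin d) ℝ :=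
  ∑ i, MvPolynomial.C (2 * (q.1 - a.1) i) * MvPolynomial.X i + MvPolynomial.C (lift a - lift q)

theorem totalDegree_gapPolynomial_le (a q : WPoint d) : (gapPolynomial a q).totalDegree ≤ 1 := by
  refine (MvPolynomial.totalDegree_add _ _).trans
    (max_le ?_ ((MvPolynomial.totalDegree_C _).trans_le zero_le_one))
  refine MvPolynomial.totalDegree_finsetSum_le fun i _ => ?_
  refine (MvPolynomial.totalDegree_mul _ _).trans ?_
  rw [MvPolynomial.totalDegree_C, MvPolynomial.totalDegree_X]

theorem eval_gapPolynomial {a z : WPoint d} (hz : polar z a.1 = lift a) (q : WPoint d) :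
    MvPolynomial.eval z.1 (gapPolynomial a q) = polar z q.1 - lift q := by
  have h := polar_sub z q.1 a.1
  have e : inner ℝ z.1 (q.1 - a.1) = ∑ i, (q.1 - a.1) i * z.1 i := by
    simp [PiLp.inner_apply]
  rw [← sub_add_cancel (polar z q.1) (polar z a.1), h, hz, e, gapPolynomial]
  simp only [map_add, map_sum, map_mul, MvPolynomial.eval_C, MvPolynomial.eval_X, Finset.mul_sum,
    mul_assoc]
  ring

theorem coverCount_heft_le_incident (hd : 1 ≤ d) (k : ℕ) (hW : IsThinDeloneWeighted W)
    (hg : IsGenericWeighted W) (a : WPoint d) {x : EuclideanSpace ℝ (Fin d)}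
    (hx : OffHyperplanes (locations W) x) :
    coverCount {T ∈ simplices W | heft W T ≤ (k : ℕ∞) ∧ a ∈ T} x ≤ ((d + k).choose d : ℕ∞) := by
  classical
  unfold coverCount
  set Φ := {T ∈ {T ∈ simplices W | heft W T ≤ (k : ℕ∞) ∧ a ∈ T} |
    x ∈ convexHull ℝ (locations (T : Set (WPoint d)))}
  have hfin : Φ.Finite := (finite_simplices_near hd hW hg k x).subset fun T hT =>
    ⟨hT.1.1, hT.1.2.1, x, Metric.mem_closedBall_self zero_le_one, hT.2⟩
  have : Fintype Φ := hfin.fintype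
  rw [hfin.encard_eq_coe_toFinset_card]
  have heval : ∀ T T' : Φ, MvPolynomial.eval (orthoPoint (T : Finset (WPoint d))).1
      (∏ q ∈ (hW.finite_below (orthoPoint (T' : Finset (WPoint d)))).toFinset, gapPolynomial a q)
      = ∏ q ∈ (hW.finite_below (orthoPoint (T' : Finset (WPoint d)))).toFinset,
        (polar (orthoPoint (T : Finset (WPoint d))) q.1 - lift q) := fun T T' => by
    rw [map_prod]
    exact Finset.prod_congr rfl fun q _ =>
      eval_gapPolynomial (polar_orthoPoint hg T.2.1.1 a T.2.1.2.2) q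
  have hcard := card_le_choose_of_triangular (ι := Φ) (d := d) (k := k)
    (fun T => (orthoPoint (T : Finset (WPoint d))).1)
    (fun T => ∏ q ∈ (hW.finite_below (orthoPoint (T : Finset (WPoint d)))).toFinset,
      gapPolynomial a q)
    (fun T => polar (orthoPoint (T : Finset (WPoint d))) x) (fun T => ?_) (fun T => ?_) ?_
  · rw [← hfin.card_toFinset] at hcard
    exact_mod_cast hcard
  · refine (MvPolynomial.totalDegree_finsetProd _ _).trans ?_
    refine (Finset.sum_le_card_nsmul _ _ 1 fun q _ => totalDegree_gapPolynomial_le a q).trans ?_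
    have := T.2.1.2.1
    rw [heft_eq_card hW] at this
    rw [smul_eq_mul, mul_one]
    exact_mod_cast this
  · rw [heval T T, Finset.prod_ne_zero_iff]
    intro q hq
    exact (sub_pos.2 ((hW.finite_below _).mem_toFinset.1 hq).2).ne'
  · intro T T' hne hle
    rw [heval T T']
    -- By the order at `x`, some vertex of `T` lies below the graph of `T'`. Its factor in the
    -- product for `T'` vanishes at the orthogonal point of `T`.
    obtain ⟨p, hp, hlt⟩ : ∃ p ∈ (T : Finset (WPoint d)),
        lift p < polar (orthoPoint (T' : Finset (WPoint d))) p.1 := by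
      by_contra! h
      exact (polar_lt_of_not_below hd hW hg hx T.2.1.1 T'.2.1.1 T.2.2
        (fun h => hne (Subtype.ext h)) h).not_ge hle
    refine Finset.prod_eq_zero ((hW.finite_below _).mem_toFinset.2 ⟨T.2.1.1.1 hp, hlt⟩) ?_
    rw [polar_orthoPoint hg T.2.1.1 p hp, sub_self]

end WeightedHefty

theorem theorem2p6 (d : ℕ) (hd : 1 ≤ d) (k : ℕ) (W : Set (WeightedHefty.WPoint d))
    (hthin : WeightedHefty.IsThinDeloneWeighted W)
    (hgen : WeightedHefty.IsGenericWeighted W) :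
    ((∀ x : EuclideanSpace ℝ (Fin d),
        WeightedHefty.IsGenericPoint (WeightedHefty.locations W) x →
        WeightedHefty.coverCount
          {T ∈ WeightedHefty.simplices W | WeightedHefty.heft W T = (k : ℕ∞)} x
          = ((d + k).choose d : ℕ∞)) ∧
      (∀ᵐ x : EuclideanSpace ℝ (Fin d) ∂volume,
        WeightedHefty.coverCount
          {T ∈ WeightedHefty.simplices W | WeightedHefty.heft W T = (k : ℕ∞)} x
          = ((d + k).choose d : ℕ∞)) ∧
      (∀ x : EuclideanSpace ℝ (Fin d),
        ((d + k).choose d : ℕ∞) ≤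
        WeightedHefty.coverCount
          {T ∈ WeightedHefty.simplices W | WeightedHefty.heft W T = (k : ℕ∞)} x)) ∧
    (∀ a ∈ W, ∃ ε : ℝ, 0 < ε ∧
      (∀ x ∈ Metric.ball a.1 ε,
        WeightedHefty.IsGenericPoint (WeightedHefty.locations W) x →
        WeightedHefty.coverCount
          {T ∈ WeightedHefty.simplices W | WeightedHefty.heft W T ≤ (k : ℕ∞) ∧ a ∈ T} x
          ≤ ((d + k).choose d : ℕ∞)) ∧
      (∀ᵐ x ∂(volume.restrict (Metric.ball a.1 ε)),
        WeightedHefty.coverCount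
          {T ∈ WeightedHefty.simplices W | WeightedHefty.heft W T ≤ (k : ℕ∞) ∧ a ∈ T} x
          ≤ ((d + k).choose d : ℕ∞))) := by
  have hae := WeightedHefty.ae_offHyperplanes_locations hd hthin hgen
  -- The radius `1` is arbitrary: the bound at a vertex holds for every `x` off the hyperplanes.
  refine ⟨⟨fun x hx => WeightedHefty.coverCount_heft_eq hd k hthin hgen hx.offHyperplanes,
    hae.mono fun x hx => WeightedHefty.coverCount_heft_eq hd k hthin hgen hx,
    WeightedHefty.choose_le_coverCount_heft hd k hthin hgen⟩, fun a _ => ⟨1, one_pos,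
    fun x _ hx => WeightedHefty.coverCount_heft_le_incident hd k hthin hgen a hx.offHyperplanes,
    ae_restrict_of_ae (hae.mono fun x hx =>
      WeightedHefty.coverCount_heft_le_incident hd k hthin hgen a hx)⟩⟩
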